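/- A polynomial in $\mathbb{R}[x]$ is called hyperbolic if it is identically zero or all of its complex zeros are real; a linear operator $T:\mathbb{R}[x]\to\mathbb{R}[x]$ is a hyperbolicity preserver if $T[f]$ is hyperbolic whenever $f$ is. Given a basis $\{P_n\}_{n\ge 0}$ of $\mathbb{R}[x]$, a real sequence $\{A_n\}_{n\ge 0}$ is called a $P_n$-multiplier sequence if there is a hyperbolicity preserver $T$ with $T[P_n]=A_nP_n$ for every $n\ge 0$. For $\alpha,\beta\in\mathbb{R}$ let $$P_n^{\alpha,\beta}(x)=\sum_{k=0}^{n}\frac{(\alpha+k+1)_{n-k}\,(n+\alpha+\beta+1)_k}{k!\,(n-k)!}\Big(\frac{x-1}{2}\Big)^k,\qquad (y)_k=y(y+1)\cdots(y+k-1),\quad (y)_0=1,$$ be the Jacobi polynomials. **Theorem.** Let $\alpha,\beta\in\mathbb{R}$ be such that $\{P_n^{\alpha,\beta}\}_{n\ge 0}$ is a basis of $\mathbb{R}[x]$ (equivalently, $\alpha+\beta\notin\{-2,-3,-4,\dots\}$), and let $A,B\in\mathbb{R}$ with $A\ne 0$. Then $\{An(n+\alpha+\beta+1)+B\}_{n\ge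 0}$ is a $P_n^{\alpha,\beta}$-multiplier sequence if and only if $$0\le \frac{B}{A}\le(\alpha+1)(\beta+1)\quad\text{and}\quad \alpha\ge -1,\ \beta\ge -1.$$ -/

import Mathlib

open Polynomial

/-- A real polynomial is hyperbolic if it is zero or all its complex zeros are real. -/
def Hyperbolic (f : ℝ[X]) : Prop :=
  f = 0 ∨ ∀ z : ℂ, aeval z f = 0 → z.im = 0

/-- A linear operator on `ℝ[x]` which maps hyperbolic polynomials to hyperbolic polynomials. -/
def PreservesHyperbolicity (T : ℝ[X] →ₗ[ℝ] ℝ[X]) : Prop :=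
  ∀ f : ℝ[X], Hyperbolic f → Hyperbolic (T f)

/-- `a` is a multiplier sequence for the basis `P` of `ℝ[x]`: some hyperbolicity preserver `T`
satisfies `T (P n) = a n • P n` for every `n` (including `n = 0`). -/
def IsMultiplierSequence (P : Module.Basis ℕ ℝ ℝ[X]) (a : ℕ → ℝ) : Prop :=
  ∃ T : ℝ[X] →ₗ[ℝ] ℝ[X], PreservesHyperbolicity T ∧ ∀ n : ℕ, T (P n) = a n • P n

/-- The Jacobi polynomial with arbitrary real parameters `α`, `β`,
`P_n^{α,β}(x) = ∑_{k=0}^n (α+k+1)_{n-k} (n+α+β+1)_k / (k! (n-k)!) * ((x-1)/2)^k`,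
where `(y)_k = y (y+1) ⋯ (y+k-1)`. -/
noncomputable def jacobiPoly (α β : ℝ) (n : ℕ) : ℝ[X] :=
  ∑ k ∈ Finset.range (n + 1),
    C ((ascPochhammer ℝ (n - k)).eval (α + k + 1) * (ascPochhammer ℝ k).eval (n + α + β + 1)
        / ((k.factorial : ℝ) * ((n - k).factorial : ℝ))) *
      (C (1 / 2) * (X - 1)) ^ k

/-! By the Jacobi differential equation, the only operator with these eigenvalues on the basis is
`A` times `jacobiOperator 1 u v c`, with u = α + 1, v = β + 1, c = B / A. It remains to see that
this operator preserves hyperbolicity iff u, v ≥ 0 and 0 ≤ c ≤ uv. Necessity: the images of (x -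
s)^m ((x - s)² - K²) and (x - r)^(m + 2) reduce to a cubic and a quadratic, which violate Laguerre's
inequality or a discriminant bound for suitable m, K, r. Sufficiency: off the real axis, Tf / f is a
quadratic form in the numbers -1/(z - xᵢ), -1/(z ∓ s). It has Lorentzian signature, so it cannot
vanish when all of them lie in the upper half plane (`quadratic_form_ne_zero`). -/

/-! ### Real-rooted polynomials. -/

theorem hyperbolic_of_natDegree_le_one {f : ℝ[X]} (hf : f.natDegree ≤ 1) : Hyperbolic f := by
  obtain ⟨a, b, rfl⟩ := exists_eq_X_add_C_of_natDegree_le_one hf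
  by_cases ha : a = 0
  · subst ha
    by_cases hb : b = 0
    · left; simp [hb]
    · right
      intro z hz
      simp [hb] at hz
  · right
    intro z hz
    have h := congrArg Complex.im hz
    simpa [ha] using h

theorem Hyperbolic.of_mul_left {f g : ℝ[X]} (hg : g ≠ 0) (h : Hyperbolic (g * f)) :
    Hyperbolic f := by
  rcases h with h | h
  · exact Or.inl ((mul_eq_zero.mp h).resolve_left hg)
  · exact Or.inr fun z hz => h z (by simp [hz])

theorem Hyperbolic.mul {f g : ℝ[X]} (hf : Hyperbolic f) (hg : Hyperbolic g) :
    Hyperbolic (f * g) := by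
  rcases hf with rfl | hf
  · left; simp
  rcases hg with rfl | hg
  · left; simp
  right
  intro z hz
  rw [map_mul, mul_eq_zero] at hz
  exact hz.elim (hf z) (hg z)

theorem hyperbolic_X_sub_C (r : ℝ) : Hyperbolic (X - C r) :=
  hyperbolic_of_natDegree_le_one (natDegree_X_sub_C_le r)

theorem Hyperbolic.pow {f : ℝ[X]} (hf : Hyperbolic f) (n : ℕ) : Hyperbolic (f ^ n) := by
  induction n with
  | zero => exact hyperbolic_of_natDegree_le_one (by simp)
  | succ n ih => rw [pow_succ]; exact ih.mul hf

theorem Hyperbolic.splits {f : ℝ[X]} (hf : Hyperbolic f) : f.Splits := by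
  rcases hf with rfl | hf
  · exact Splits.zero
  · refine Splits.of_splits_map (algebraMap ℝ ℂ) (IsAlgClosed.splits _) fun z hz => ?_
    have hz' := (mem_roots'.mp hz).2
    rw [IsRoot, eval_map_algebraMap] at hz'
    exact ⟨z.re, Complex.ext (by simp) (by simp [hf z hz'])⟩

theorem Polynomial.Splits.hyperbolic {f : ℝ[X]} (hf : f.Splits) : Hyperbolic f := by
  by_cases h0 : f = 0
  · exact Or.inl h0
  right
  intro z hz
  obtain ⟨x, rfl⟩ := hf.mem_range_of_isRoot h0 (i := algebraMap ℝ ℂ) (x := z)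
    (by rwa [IsRoot, eval_map_algebraMap])
  simp

/-- Rolle's theorem, counting roots with multiplicity. -/
theorem Polynomial.Splits.derivative_real {f : ℝ[X]} (hf : f.Splits) :
    (derivative f).Splits := by
  rw [splits_iff_card_roots] at hf ⊢
  have h1 := card_roots_le_derivative f
  have h2 := natDegree_derivative_le f
  have h3 := card_roots' (derivative f)
  omega

theorem Hyperbolic.derivative {f : ℝ[X]} (hf : Hyperbolic f) : Hyperbolic (derivative f) :=
  hf.splits.derivative_real.hyperbolic

theorem Hyperbolic.exists_eq_prod {f : ℝ[X]} (hf : Hyperbolic f) :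
    ∃ (a : ℝ) (n : ℕ) (x : Fin n → ℝ), f = C a * ∏ i, (X - C (x i)) := by
  refine ⟨f.leadingCoeff, f.roots.toList.length, fun i => f.roots.toList[i], ?_⟩
  conv_lhs => rw [hf.splits.eq_prod_roots]
  congr 1
  conv_lhs => rw [← Multiset.coe_toList f.roots]
  rw [Multiset.map_coe, Multiset.prod_coe]
  exact (Fin.prod_univ_fun_getElem f.roots.toList (fun a => X - C a)).symm

theorem aeval_derivatives_prod_X_sub_C {K ι : Type*} [Field K] [Algebra ℝ K] (S : Finset ι)
    (x : ι → ℝ) (z : K) (hz : ∀ i, z - algebraMap ℝ K (x i) ≠ 0) :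
    aeval z (derivative (∏ i ∈ S, (X - C (x i)))) =
        (∑ i ∈ S, (z - algebraMap ℝ K (x i))⁻¹) * aeval z (∏ i ∈ S, (X - C (x i))) ∧
      aeval z (derivative (derivative (∏ i ∈ S, (X - C (x i))))) =
        ((∑ i ∈ S, (z - algebraMap ℝ K (x i))⁻¹) ^ 2 -
          ∑ i ∈ S, ((z - algebraMap ℝ K (x i))⁻¹) ^ 2) * aeval z (∏ i ∈ S, (X - C (x i))) := by
  classical
  induction S using Finset.induction_on with
  | empty => simp
  | insert i S hi ih =>
    obtain ⟨h1, h2⟩ := ih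
    have hne := hz i
    rw [Finset.prod_insert hi, Finset.sum_insert hi, Finset.sum_insert hi]
    set g := ∏ i ∈ S, (X - C (x i)) with hg
    constructor
    · rw [derivative_mul, derivative_X_sub_C]
      simp only [map_add, map_mul, map_sub, aeval_X, aeval_C, h1, one_mul]
      field_simp
    · rw [derivative_mul, derivative_X_sub_C, one_mul, derivative_add, derivative_mul,
        derivative_X_sub_C, one_mul]
      simp only [map_add, map_mul, map_sub, aeval_X, aeval_C, h1, h2]
      field_simp
      ring

/-- Laguerre's inequality. -/
theorem Hyperbolic.laguerre_inequality {f : ℝ[X]} (hf : Hyperbolic f) (y : ℝ) :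
    f.eval y * (Polynomial.derivative (Polynomial.derivative f)).eval y ≤
      (Polynomial.derivative f).eval y ^ 2 := by
  obtain ⟨a, n, x, rfl⟩ := hf.exists_eq_prod
  by_cases h : ∀ i, y - x i ≠ 0
  · obtain ⟨h1, h2⟩ := aeval_derivatives_prod_X_sub_C (K := ℝ) Finset.univ x y h
    simp only [coe_aeval_eq_eval, Algebra.algebraMap_self, RingHom.id_apply] at h1 h2
    simp only [derivative_mul, derivative_C, zero_mul, zero_add, eval_mul, eval_C, h1, h2]
    have h3 : 0 ≤ ∑ i, ((y - x i)⁻¹) ^ 2 := Finset.sum_nonneg fun i _ => sq_nonneg _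
    have h4 := mul_nonneg h3 (sq_nonneg (a * eval y (∏ i, (X - C (x i)))))
    nlinarith
  · push Not at h
    obtain ⟨i, hi⟩ := h
    have h0 : eval y (C a * ∏ i, (X - C (x i))) = 0 := by
      rw [eval_mul, eval_prod, Finset.prod_eq_zero (Finset.mem_univ i) (by simpa using hi),
        mul_zero]
    rw [h0, zero_mul]
    exact sq_nonneg _

theorem Hyperbolic.four_mul_le_sq {a b c r : ℝ}
    (h : Hyperbolic (C a * (X - C r) ^ 2 + C b * (X - C r) + C c)) : 4 * a * c ≤ b ^ 2 := by
  by_contra! hlt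
  have ha : a ≠ 0 := by
    rintro rfl
    nlinarith [sq_nonneg b]
  rcases h with h | h
  · have h1 := congrArg (fun p => eval r (Polynomial.derivative (Polynomial.derivative p))) h
    simp [derivative_pow] at h1
    exact ha h1
  · set d := Real.sqrt (4 * a * c - b ^ 2) with hd
    have hdpos : 0 < d := Real.sqrt_pos.mpr (by linarith)
    have hd2 : d ^ 2 = 4 * a * c - b ^ 2 := Real.sq_sqrt (by linarith)
    have hd2' : (d : ℂ) ^ 2 = 4 * a * c - b ^ 2 := by exact_mod_cast hd2
    have ha' : (a : ℂ) ≠ 0 := by exact_mod_cast ha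
    have h1 := h (((r - b / (2 * a) : ℝ) : ℂ) + ((d / (2 * a) : ℝ) : ℂ) * Complex.I) (by
      simp only [map_add, map_mul, map_pow, map_sub, aeval_X, aeval_C, Complex.coe_algebraMap]
      push_cast
      have hI : Complex.I ^ 2 = -1 := Complex.I_sq
      field_simp
      ring_nf
      rw [hI, hd2']
      ring)
    rw [Complex.add_im, Complex.ofReal_im, Complex.im_ofReal_mul, Complex.I_im] at h1
    have h2 : d / (2 * a) ≠ 0 := div_ne_zero hdpos.ne' (mul_ne_zero two_ne_zero ha)
    exact h2 (by linarith)

/-! ### The differential operator and its action on powers. -/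

/-- The differential operator `(x² - s²) D² + (u (x + s) + v (x - s)) D + c`. -/
noncomputable def jacobiOperator (s u v c : ℝ) : ℝ[X] →ₗ[ℝ] ℝ[X] :=
  LinearMap.mulLeft ℝ ((X + C s) * (X - C s)) ∘ₗ derivative ∘ₗ derivative +
    LinearMap.mulLeft ℝ (C u * (X + C s) + C v * (X - C s)) ∘ₗ derivative + c • LinearMap.id

theorem jacobiOperator_apply (s u v c : ℝ) (f : ℝ[X]) :
    jacobiOperator s u v c f = (X + C s) * (X - C s) * derivative (derivative f) +
      (C u * (X + C s) + C v * (X - C s)) * derivative f + C c * f := by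
  simp [jacobiOperator, smul_eq_C_mul, mul_assoc]

theorem jacobiOperator_swap (s u v c : ℝ) :
    jacobiOperator s u v c = jacobiOperator (-s) v u c := by
  refine LinearMap.ext fun f => ?_
  simp only [jacobiOperator_apply, C_neg]
  ring

theorem jacobiOperator_X_sub_C_pow (s u v c r : ℝ) (m : ℕ) :
    jacobiOperator s u v c ((X - C r) ^ (m + 2)) =
      (X - C r) ^ m * (C ((m + 2) * (m + 1) + (m + 2) * (u + v) + c) * (X - C r) ^ 2 +
        C (2 * ((m + 2) * (m + 1)) * r + (m + 2) * (u * (r + s) + v * (r - s))) * (X - C r) +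
        C ((m + 2) * (m + 1) * (r ^ 2 - s ^ 2))) := by
  have h1 : derivative ((X - C r) ^ (m + 2)) = C ((m : ℝ) + 2) * (X - C r) ^ (m + 1) := by
    rw [derivative_X_sub_C_pow]
    simp
  have h2 : derivative (C ((m : ℝ) + 2) * (X - C r) ^ (m + 1)) =
      C ((m : ℝ) + 2) * (C ((m : ℝ) + 1) * (X - C r) ^ m) := by
    rw [derivative_C_mul, derivative_X_sub_C_pow]
    simp
  rw [jacobiOperator_apply, h1, h2]
  simp only [map_add, map_mul, map_sub, C_ofNat, C_1, map_pow]
  ring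

/-- The extra factor `X - C s` avoids the exponent k - 1, so that k = 0 needs no separate form. -/
theorem X_sub_C_mul_jacobiOperator_pow (s u v c : ℝ) (k : ℕ) :
    (X - C s) * jacobiOperator s u v c ((X - C s) ^ k) =
      (X - C s) ^ k * (C (k * (k - 1) + k * (u + v) + c) * (X - C s) +
        C (2 * s * (k * (k - 1 + u)))) := by
  rcases k with _ | _ | k
  · simp [jacobiOperator_apply]
    ring
  · rw [jacobiOperator_apply, zero_add, pow_one, derivative_X_sub_C, derivative_one, Nat.cast_one]
    simp only [map_add, map_mul, map_sub, C_ofNat, C_1]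
    ring
  · rw [jacobiOperator_X_sub_C_pow]
    push_cast
    simp only [map_add, map_mul, map_sub, C_ofNat, C_1, map_pow]
    ring

/-! ### Necessity of the conditions. -/

theorem PreservesHyperbolicity.hyperbolic_cubic {s u v c : ℝ}
    (h : PreservesHyperbolicity (jacobiOperator s u v c)) (m : ℕ) (K : ℝ) :
    Hyperbolic (C ((m + 2) * (m + 1) + (m + 2) * (u + v) + c) * (X - C s) ^ 3 +
      C (2 * s * ((m + 2) * (m + 1 + u))) * (X - C s) ^ 2 +
      C (-(K ^ 2 * (m * (m - 1) + m * (u + v) + c))) * (X - C s) +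
      C (-(K ^ 2 * (2 * s * (m * (m - 1 + u)))))) := by
  have hf : Hyperbolic ((X - C s) ^ (m + 2) - K ^ 2 • (X - C s) ^ m) := by
    have : (X - C s) ^ (m + 2) - K ^ 2 • (X - C s) ^ m =
        (X - C s) ^ m * ((X - C (s + K)) * (X - C (s - K))) := by
      simp only [smul_eq_C_mul, map_add, map_sub, map_pow]
      ring
    rw [this]
    exact ((hyperbolic_X_sub_C s).pow m).mul ((hyperbolic_X_sub_C _).mul (hyperbolic_X_sub_C _))
  refine Hyperbolic.of_mul_left (pow_ne_zero m (X_sub_C_ne_zero s)) ?_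
  have := (hyperbolic_X_sub_C s).mul (h _ hf)
  rw [map_sub, map_smul, mul_sub, mul_smul_comm, X_sub_C_mul_jacobiOperator_pow,
    X_sub_C_mul_jacobiOperator_pow] at this
  convert this using 1
  push_cast
  simp only [smul_eq_C_mul, map_add, map_mul, map_sub, map_neg, C_ofNat, C_1, map_pow]
  ring

theorem PreservesHyperbolicity.nonneg_left {s u v c : ℝ} (hs : s ≠ 0)
    (h : PreservesHyperbolicity (jacobiOperator s u v c)) : 0 ≤ u := by
  by_contra! hu
  -- With this m, 0 ≤ m + u < 1, so m - 1 + u and m + 1 + u have opposite signs. In the cubic at s,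
  -- f f'' is then positive of order K², against f'² of order K⁴: small K breaks Laguerre's
  -- inequality.
  set m := ⌈-u⌉₊ with hm
  have h1 : -u ≤ m := Nat.le_ceil _
  have h2 : (m : ℝ) < -u + 1 := Nat.ceil_lt_add_one (by linarith)
  have hm0 : (0 : ℝ) < m := by linarith
  set L : ℝ := m * (m - 1) + m * (u + v) + c with hL
  set M : ℝ := (m + 2) * (m + 1 + u) * (m * (1 - m - u)) with hM
  have hMpos : 0 < M := by
    have : 0 < m + 1 + u := by linarith
    have : 0 < 1 - m - u := by linarith
    positivity
  have key (K : ℝ) (hK : 0 < K) : 8 * s ^ 2 * M ≤ K ^ 2 * L ^ 2 := by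
    have h3 := (h.hyperbolic_cubic m K).laguerre_inequality s
    simp [derivative_pow] at h3
    have hK2 : 0 < K ^ 2 := by positivity
    refine le_of_mul_le_mul_left ?_ hK2
    rw [hM, hL]
    nlinarith
  have hP : 0 < 8 * s ^ 2 * M := by positivity
  have hD : 0 < L ^ 2 + 1 := by positivity
  have h4 := key (Real.sqrt (8 * s ^ 2 * M / (L ^ 2 + 1))) (Real.sqrt_pos.mpr (by positivity))
  rw [Real.sq_sqrt (by positivity), div_mul_eq_mul_div, le_div_iff₀ hD] at h4
  nlinarith

theorem PreservesHyperbolicity.nonneg_right {s u v c : ℝ} (hs : s ≠ 0)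
    (h : PreservesHyperbolicity (jacobiOperator s u v c)) : 0 ≤ v := by
  rw [jacobiOperator_swap] at h
  exact h.nonneg_left (neg_ne_zero.mpr hs)

theorem PreservesHyperbolicity.const_nonneg {s u v c : ℝ} (hu : 0 ≤ u) (hv : 0 ≤ v)
    (h : PreservesHyperbolicity (jacobiOperator s u v c)) : 0 ≤ c := by
  by_contra! hc
  let l : ℕ → ℝ := fun m => m * (m - 1) + m * (u + v) + c
  have hex : ∃ k, 0 ≤ l k := by
    obtain ⟨k, hk⟩ := exists_nat_ge (-c + 1)
    refine ⟨k, ?_⟩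
    have : 0 ≤ k * (u + v) := by positivity
    have : 0 ≤ ((k : ℝ) - 1 + c) := by linarith
    simp only [l]
    nlinarith
  classical
  -- `l k` is the factor on the leading coefficient in degree k, and `l 0 = c`. At a sign change,
  -- the derivative of the cubic has outer coefficients of the same sign, and large K makes its
  -- discriminant negative.
  obtain ⟨m, hm, hm'⟩ : ∃ m, l m < 0 ∧ 0 ≤ l (m + 1) := by
    have hne : Nat.find hex ≠ 0 := by
      intro h0
      have := Nat.find_spec hex
      rw [h0] at this
      simp [l] at this
      linarith
    obtain ⟨m, hm⟩ := Nat.exists_eq_succ_of_ne_zero hne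
    refine ⟨m, not_le.mp (Nat.find_min hex (by omega)), ?_⟩
    have := Nat.find_spec hex
    rwa [hm] at this
  have hm2 : 0 < l (m + 2) := by
    simp only [l] at hm' ⊢
    push_cast at hm' ⊢
    have : (0 : ℝ) ≤ m := m.cast_nonneg
    nlinarith
  set μ : ℝ := 2 * s * ((m + 2) * (m + 1 + u)) with hμ
  have key (K : ℝ) : 3 * K ^ 2 * (l (m + 2) * -l m) ≤ μ ^ 2 := by
    have h3 := (h.hyperbolic_cubic m K).derivative
    have h4 : Hyperbolic (C (3 * l (m + 2)) * (X - C s) ^ 2 + C (2 * μ) * (X - C s) +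
        C (-(K ^ 2 * l m))) := by
      convert h3 using 1
      simp only [derivative_mul, derivative_C, derivative_X_sub_C_pow, derivative_X_sub_C,
        map_add, l, hμ]
      push_cast
      simp only [map_add, map_mul, map_sub, map_neg, C_ofNat, C_1, map_pow]
      ring
    have h5 := h4.four_mul_le_sq
    nlinarith
  have hP : 0 < l (m + 2) * -l m := mul_pos hm2 (neg_pos.mpr hm)
  have h6 := key (Real.sqrt ((μ ^ 2 + 1) / (l (m + 2) * -l m)))
  rw [Real.sq_sqrt (by positivity), mul_assoc, div_mul_cancel₀ _ hP.ne'] at h6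
  nlinarith [sq_nonneg μ]

theorem PreservesHyperbolicity.const_le_mul {u v c : ℝ} (hu : 0 ≤ u) (hv : 0 ≤ v)
    (h : PreservesHyperbolicity (jacobiOperator 1 u v c)) : c ≤ u * v := by
  by_contra! hlt
  have huv : 0 ≤ u * v := mul_nonneg hu hv
  obtain ⟨m, hm⟩ := exists_nat_gt (u * v / (c - u * v))
  rw [div_lt_iff₀ (by linarith)] at hm
  have hm0 : (0 : ℝ) ≤ m := m.cast_nonneg
  set n : ℝ := (m : ℝ) + 2 with hn
  set k : ℝ := (m : ℝ) + 1 with hk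
  -- The discriminant of the quadratic factor of T (x - r)^n, divided by n, is a quadratic in r that
  -- is nonnegative everywhere. Its own discriminant has the sign of kc - nuv, positive by the
  -- choice of m.
  have hdisc := discrim_le_zero (K := ℝ)
    (a := n * (u + v) ^ 2 - 4 * k * c) (b := 2 * n * (2 * k + u + v) * (u - v))
    (c := n * (u - v) ^ 2 + 4 * k * (n * k + n * (u + v) + c)) fun r => by
      have h1 := h _ ((hyperbolic_X_sub_C r).pow (m + 2))
      rw [jacobiOperator_X_sub_C_pow] at h1
      have h2 := (h1.of_mul_left (pow_ne_zero m (X_sub_C_ne_zero r))).four_mul_le_sq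
      have hnpos : 0 < n := by positivity
      refine le_of_mul_le_mul_left ?_ hnpos
      rw [← hn, ← hk] at h2
      have hnk : n = k + 1 := by rw [hn, hk]; ring
      rw [hnk] at h2 ⊢
      nlinarith
  rw [discrim] at hdisc
  have hnk : n = k + 1 := by rw [hn, hk]; ring
  have hkpos : 0 < k := by positivity
  have hnpos : 0 < n := by positivity
  have hc : 0 < c := by linarith
  have h3 : 0 < k * c - n * (u * v) := by rw [hnk, hk]; nlinarith
  have h4 : 0 < 16 * (k * c - n * (u * v)) * (k * (n * k + n * (u + v) + c)) := by positivity
  have h5 : (2 * n * (2 * k + u + v) * (u - v)) ^ 2 - 4 * (n * (u + v) ^ 2 - 4 * k * c) *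
      (n * (u - v) ^ 2 + 4 * k * (n * k + n * (u + v) + c)) =
      4 * (16 * (k * c - n * (u * v)) * (k * (n * k + n * (u + v) + c))) := by
    ring
  linarith

/-! ### Sufficiency: a Lorentzian quadratic form. -/

theorem quadratic_form_nonneg {u v c : ℝ} (hc : 0 ≤ c) (hcuv : c ≤ u * v) (x y : ℝ) :
    0 ≤ (u * x + v * y) ^ 2 / 4 - c * (x * y) := by
  rcases le_total (x * y) 0 with h | h
  · nlinarith [sq_nonneg (u * x + v * y)]
  · nlinarith [sq_nonneg (u * x - v * y), mul_le_mul_of_nonneg_right hcuv h]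

/-- For a form ℓ² - N with N ≥ 0, two orthogonal vectors cannot both have value q > 0: N at ℓ(b)a -
ℓ(a)b would be -q(ℓ(a)² + ℓ(b)²). -/
theorem no_orthogonal_positive_pair {a b q na nb nab : ℝ} (hb : b ≠ 0) (hq : 0 < q)
    (ha : a ^ 2 - q = na) (hb' : b ^ 2 - q = nb) (hab : a * b = nab)
    (hn : 0 ≤ b ^ 2 * na - 2 * a * b * nab + a ^ 2 * nb) : False := by
  subst ha hb' hab
  have : 0 < q * b ^ 2 := by positivity
  have : 0 ≤ q * a ^ 2 := by positivity
  linarith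

/-- The quadratic form `(∑ s)² - ∑ s² + (u ω₁ + v ω₂) ∑ s + c ω₁ ω₂` does not vanish when all of its
variables lie in the open upper half plane. -/
theorem quadratic_form_ne_zero {ι : Type*} {S : Finset ι} (hS : S.Nontrivial) {u v c : ℝ}
    (hu : 0 ≤ u) (hv : 0 ≤ v) (hc : 0 ≤ c) (hcuv : c ≤ u * v) {s : ι → ℂ} {w₁ w₂ : ℂ}
    (hs : ∀ i, 0 < (s i).im) (hw₁ : 0 < w₁.im) (hw₂ : 0 < w₂.im) :
    (∑ i ∈ S, s i) ^ 2 - ∑ i ∈ S, s i ^ 2 + (u * w₁ + v * w₂) * ∑ i ∈ S, s i + c * (w₁ * w₂) ≠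
      0 := by
  intro h0
  have hre := congrArg Complex.re h0
  have him := congrArg Complex.im h0
  simp only [Complex.add_re, Complex.sub_re, Complex.mul_re, Complex.add_im, Complex.sub_im,
    Complex.mul_im, Complex.ofReal_re, Complex.ofReal_im, sq, Complex.re_sum, Complex.im_sum,
    Complex.zero_re, Complex.zero_im, Finset.sum_sub_distrib, Finset.sum_add_distrib] at hre him
  set σ := ∑ i ∈ S, (s i).re
  set τ := ∑ i ∈ S, (s i).im
  have hτ : 0 < τ := Finset.sum_pos (fun i _ => hs i) hS.nonempty
  -- Two indices are needed for strictness; it makes the form positive at the vector of imaginary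
  -- parts.
  have hlt : ∑ i ∈ S, (s i).im * (s i).im < τ * τ := by
    rw [Finset.sum_mul]
    refine Finset.sum_lt_sum_of_nonempty hS.nonempty fun i hi => ?_
    refine mul_lt_mul_of_pos_left ?_ (hs i)
    obtain ⟨j, hj, hji⟩ := hS.exists_ne i
    exact Finset.single_lt_sum hji hi hj (hs j) fun k _ _ => (hs k).le
  have hcomm : ∑ i ∈ S, (s i).im * (s i).re = ∑ i ∈ S, (s i).re * (s i).im :=
    Finset.sum_congr rfl fun i _ => mul_comm _ _
  rw [hcomm] at him
  set Laa := ∑ i ∈ S, (s i).re * (s i).re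
  set Lab := ∑ i ∈ S, (s i).re * (s i).im
  set Lbb := ∑ i ∈ S, (s i).im * (s i).im
  -- Completing the square in ∑ s gives ℓ² - N; `la`, `lb` are ℓ at the real and imaginary parts.
  set la := σ + (u * w₁.re + v * w₂.re) / 2 with hla
  set lb := τ + (u * w₁.im + v * w₂.im) / 2 with hlb
  have hlbpos : 0 < lb := by positivity
  have hsum : 0 ≤ lb ^ 2 * Laa - 2 * la * lb * Lab + la ^ 2 * Lbb := by
    have : lb ^ 2 * Laa - 2 * la * lb * Lab + la ^ 2 * Lbb =
        ∑ i ∈ S, (lb * (s i).re - la * (s i).im) ^ 2 := by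
      simp only [Laa, Lab, Lbb, Finset.mul_sum]
      rw [← Finset.sum_sub_distrib, ← Finset.sum_add_distrib]
      exact Finset.sum_congr rfl fun i _ => by ring
    rw [this]
    exact Finset.sum_nonneg fun i _ => sq_nonneg _
  have hM := quadratic_form_nonneg hc hcuv (lb * w₁.re - la * w₁.im) (lb * w₂.re - la * w₂.im)
  set q := τ * τ - Lbb + (u * w₁.im + v * w₂.im) * τ + c * (w₁.im * w₂.im) with hq
  have hqpos : 0 < q := by
    have : 0 ≤ (u * w₁.im + v * w₂.im) * τ := by positivity
    have : 0 ≤ c * (w₁.im * w₂.im) := by positivity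
    linarith
  have e1 : la ^ 2 - q = Laa + ((u * w₁.re + v * w₂.re) ^ 2 / 4 - c * (w₁.re * w₂.re)) := by
    rw [hla, hq]; linarith
  have e2 : lb ^ 2 - q = Lbb + ((u * w₁.im + v * w₂.im) ^ 2 / 4 - c * (w₁.im * w₂.im)) := by
    rw [hlb, hq]; ring
  have e3 : la * lb = Lab + ((u * w₁.re + v * w₂.re) * (u * w₁.im + v * w₂.im) / 4 -
      c * (w₁.re * w₂.im + w₁.im * w₂.re) / 2) := by
    rw [hla, hlb]; linarith
  refine no_orthogonal_positive_pair hlbpos.ne' hqpos e1 e2 e3 ?_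
  linarith

theorem natDegree_jacobiOperator_linear_le (s u v c a b : ℝ) :
    (jacobiOperator s u v c (C a * X + C b)).natDegree ≤ 1 := by
  have : jacobiOperator s u v c (C a * X + C b) =
      C ((u + v + c) * a) * X + C (a * (u - v) * s + c * b) := by
    rw [jacobiOperator_apply]
    simp only [derivative_C_mul, derivative_X, derivative_C, mul_one, add_zero, mul_zero, map_add,
      map_mul, map_sub]
    ring
  rw [this]
  exact natDegree_linear_le

theorem inv_neg_im_pos {z : ℂ} (hz : 0 < z.im) : 0 < (-z⁻¹).im := by
  have h0 : z ≠ 0 := by rintro rfl; simp at hz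
  rw [Complex.neg_im, Complex.inv_im, neg_div, neg_neg]
  exact div_pos hz (Complex.normSq_pos.mpr h0)

theorem aeval_jacobiOperator_ne_zero {s u v c : ℝ} (hu : 0 ≤ u) (hv : 0 ≤ v) (hc : 0 ≤ c)
    (hcuv : c ≤ u * v) {n : ℕ} (hn : 2 ≤ n) (x : Fin n → ℝ) {z : ℂ} (hz : 0 < z.im) :
    aeval z (jacobiOperator s u v c (∏ i, (X - C (x i)))) ≠ 0 := by
  have him (r : ℝ) : 0 < (z - r).im := by simpa using hz
  have hne (r : ℝ) : z - r ≠ 0 := fun h => by simpa [h] using him r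
  have hp : z + s ≠ 0 := by simpa using hne (-s)
  have hq : z - s ≠ 0 := hne s
  obtain ⟨h1, h2⟩ := aeval_derivatives_prod_X_sub_C (K := ℂ) Finset.univ x z fun i => hne (x i)
  have hf : aeval z (∏ i, (X - C (x i))) ≠ 0 := by
    rw [map_prod]
    exact Finset.prod_ne_zero_iff.mpr fun i _ => by simpa using hne (x i)
  have hS : (Finset.univ : Finset (Fin n)).Nontrivial := by
    rw [← Finset.one_lt_card_iff_nontrivial]
    simpa using Nat.lt_of_succ_le hn
  have hQ := quadratic_form_ne_zero hS hu hv hc hcuv (s := fun i => -(z - x i)⁻¹)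
    (w₁ := -(z - s)⁻¹) (w₂ := -(z + s)⁻¹) (fun i => inv_neg_im_pos (him _))
    (inv_neg_im_pos (him s)) (inv_neg_im_pos (by simpa using him (-s)))
  simp only [neg_sq, Finset.sum_neg_distrib] at hQ
  rw [jacobiOperator_apply]
  simp only [map_add, map_mul, h1, h2, aeval_X, aeval_C, map_sub, Complex.coe_algebraMap]
  intro h
  apply hQ
  refine (mul_eq_zero.mp ?_).resolve_left (mul_ne_zero (mul_ne_zero hp hq) hf)
  rw [← h]
  field_simp
  ring

theorem preservesHyperbolicity_jacobiOperator {s u v c : ℝ} (hu : 0 ≤ u) (hv : 0 ≤ v) (hc : 0 ≤ c)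
    (hcuv : c ≤ u * v) : PreservesHyperbolicity (jacobiOperator s u v c) := by
  intro f hf
  by_cases hdeg : f.natDegree ≤ 1
  · obtain ⟨a, b, rfl⟩ := exists_eq_X_add_C_of_natDegree_le_one hdeg
    exact hyperbolic_of_natDegree_le_one (natDegree_jacobiOperator_linear_le s u v c a b)
  obtain ⟨a, n, x, rfl⟩ := hf.exists_eq_prod
  have ha : a ≠ 0 := by
    rintro rfl
    simp at hdeg
  have hn : 2 ≤ n := by
    rw [natDegree_C_mul ha, natDegree_prod_of_monic _ _ fun i _ => monic_X_sub_C _] at hdeg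
    simpa using Nat.succ_le_of_lt (not_le.mp hdeg)
  right
  intro z hz
  by_contra hne
  have key {w : ℂ} (hw : 0 < w.im) :
      aeval w (jacobiOperator s u v c (C a * ∏ i, (X - C (x i)))) ≠ 0 := by
    rw [← smul_eq_C_mul, map_smul, map_smul]
    exact smul_ne_zero ha (aeval_jacobiOperator_ne_zero hu hv hc hcuv hn x hw)
  rcases lt_or_gt_of_ne hne with h | h
  · refine key (w := (starRingEnd ℂ) z) (by simpa using h) ?_
    rw [aeval_conj, hz, map_zero]
  · exact key h hz

/-! ### The Jacobi differential equation and the conclusion. -/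

theorem ascPochhammer_succ_eval_left (n : ℕ) (y : ℝ) :
    (ascPochhammer ℝ (n + 1)).eval y = y * (ascPochhammer ℝ n).eval (y + 1) := by
  simp [ascPochhammer_succ_left]

/-- The coefficient of `((x - 1) / 2) ^ k` in `jacobiPoly α β n`. -/
noncomputable def jacobiCoeff (α β : ℝ) (n k : ℕ) : ℝ :=
  (ascPochhammer ℝ (n - k)).eval (α + k + 1) * (ascPochhammer ℝ k).eval (n + α + β + 1) /
    ((k.factorial : ℝ) * ((n - k).factorial : ℝ))

theorem jacobiCoeff_succ (α β : ℝ) {n k : ℕ} (hk : k < n) :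
    jacobiCoeff α β n (k + 1) * ((k + 1) * (k + 1 + α)) =
      jacobiCoeff α β n k * ((n - k) * (n + k + α + β + 1)) := by
  obtain ⟨d, rfl⟩ := Nat.exists_eq_add_of_lt hk
  have h1 : k + d + 1 - k = d + 1 := by omega
  have h2 : k + d + 1 - (k + 1) = d := by omega
  have h3 : α + ((k + 1 : ℕ) : ℝ) + 1 = α + k + 1 + 1 := by push_cast; ring
  have hk0 : (k.factorial : ℝ) ≠ 0 := by positivity
  have hd0 : (d.factorial : ℝ) ≠ 0 := by positivity
  have hd1 : (d : ℝ) + 1 ≠ 0 := by positivity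
  have hk1 : (k : ℝ) + 1 ≠ 0 := by positivity
  rw [jacobiCoeff, jacobiCoeff, h1, h2, h3, ascPochhammer_succ_eval, ascPochhammer_succ_eval_left,
    Nat.factorial_succ, Nat.factorial_succ]
  push_cast
  field_simp
  ring

theorem jacobiPoly_eq_sum (α β : ℝ) (n : ℕ) :
    jacobiPoly α β n =
      ∑ k ∈ Finset.range (n + 1), (jacobiCoeff α β n k / 2 ^ k) • (X - C 1) ^ k := by
  refine Finset.sum_congr rfl fun k _ => ?_
  rw [mul_pow, ← C_pow, ← mul_assoc, ← C_mul, smul_eq_C_mul, C_1, one_div, inv_pow,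
    ← div_eq_mul_inv, jacobiCoeff]

/-- The Jacobi differential equation. -/
theorem jacobiOperator_jacobiPoly (α β c : ℝ) (n : ℕ) :
    jacobiOperator 1 (α + 1) (β + 1) c (jacobiPoly α β n) =
      (n * (n + α + β + 1) + c) • jacobiPoly α β n := by
  refine mul_left_cancel₀ (X_sub_C_ne_zero 1) ?_
  rw [← sub_eq_zero, jacobiPoly_eq_sum, map_sum, Finset.smul_sum, Finset.mul_sum, Finset.mul_sum,
    ← Finset.sum_sub_distrib]
  -- The coefficient recurrence makes the sum telescope in `g`; `g 0 = 0`, and the factor n - k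
  -- kills the last term.
  let g : ℕ → ℝ[X] := fun k =>
    C (jacobiCoeff α β n k / 2 ^ k * (2 * (k * (k + α)))) * (X - C 1) ^ k
  have hterm (k : ℕ) : (X - C 1) * jacobiOperator 1 (α + 1) (β + 1) c
        ((jacobiCoeff α β n k / 2 ^ k) • (X - C 1) ^ k) -
      (X - C 1) * ((n * (n + α + β + 1) + c) • (jacobiCoeff α β n k / 2 ^ k) • (X - C 1) ^ k) =
      g k - C (jacobiCoeff α β n k * ((n - k) * (n + k + α + β + 1)) / 2 ^ k) *
        (X - C 1) ^ (k + 1) := by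
    have h1 : jacobiCoeff α β n k * ((n - k) * (n + k + α + β + 1)) / 2 ^ k =
        jacobiCoeff α β n k / 2 ^ k * ((n - k) * (n + k + α + β + 1)) := by ring
    rw [map_smul, mul_smul_comm, X_sub_C_mul_jacobiOperator_pow, h1]
    simp only [g, smul_eq_C_mul, C_mul, C_add, C_sub, C_1, C_ofNat]
    ring
  have hstep (k : ℕ) (hk : k < n) :
      g k - C (jacobiCoeff α β n k * ((n - k) * (n + k + α + β + 1)) / 2 ^ k) *
        (X - C 1) ^ (k + 1) = g k - g (k + 1) := by
    simp only [g]
    rw [← jacobiCoeff_succ α β hk]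
    congr 3
    push_cast
    field_simp
    ring
  rw [Finset.sum_congr rfl fun k _ => hterm k, Finset.sum_range_succ,
    Finset.sum_congr rfl fun k hk => hstep k (Finset.mem_range.mp hk), Finset.sum_range_sub']
  simp [g]

theorem preservesHyperbolicity_smul_iff {T : ℝ[X] →ₗ[ℝ] ℝ[X]} {a : ℝ} (ha : a ≠ 0) :
    PreservesHyperbolicity (a • T) ↔ PreservesHyperbolicity T := by
  have hC : C a ≠ 0 := C_ne_zero.mpr ha
  refine forall₂_congr fun f _ => ?_
  rw [LinearMap.smul_apply, smul_eq_C_mul]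
  exact ⟨Hyperbolic.of_mul_left hC, (hyperbolic_of_natDegree_le_one (by simp)).mul⟩

theorem mainTheorem9 (α β : ℝ) (P : Module.Basis ℕ ℝ ℝ[X])
    (hP : ∀ n : ℕ, P n = jacobiPoly α β n) (A B : ℝ) (hA : A ≠ 0) :
    IsMultiplierSequence P (fun n => A * n * (n + α + β + 1) + B) ↔
      (0 ≤ B / A ∧ B / A ≤ (α + 1) * (β + 1)) ∧ -1 ≤ α ∧ -1 ≤ β := by
  have hT (n : ℕ) : (A • jacobiOperator 1 (α + 1) (β + 1) (B / A)) (P n) =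
      (A * n * (n + α + β + 1) + B) • P n := by
    rw [hP, LinearMap.smul_apply, jacobiOperator_jacobiPoly, smul_smul]
    congr 1
    field_simp
  have hiff : IsMultiplierSequence P (fun n => A * n * (n + α + β + 1) + B) ↔
      PreservesHyperbolicity (jacobiOperator 1 (α + 1) (β + 1) (B / A)) := by
    rw [← preservesHyperbolicity_smul_iff hA]
    refine ⟨fun ⟨T, hTp, hTe⟩ => ?_, fun h => ⟨_, h, hT⟩⟩
    rwa [← P.ext fun n => (hTe n).trans (hT n).symm]
  rw [hiff]
  constructor
  · intro h
    have hu := h.nonneg_left one_ne_zero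
    have hv := h.nonneg_right one_ne_zero
    exact ⟨⟨h.const_nonneg hu hv, h.const_le_mul hu hv⟩, by linarith, by linarith⟩
  · rintro ⟨⟨hc, hcuv⟩, hα, hβ⟩
    exact preservesHyperbolicity_jacobiOperator (by linarith) (by linarith) hc hcuv
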